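/- Let $t(n) = (-1)^{s_2(n)}$ be the Thue–Morse sequence, where $s_2(n)$ is the sum of the binary digits of $n \ge 0$, and let $r(n) = (-1)^{f_{11}(n)}$ be the Rudin–Shapiro sequence, where $f_{11}(n)$ is the number of (possibly overlapping) occurrences of the pattern $11$ in the binary expansion of $n$. Write $[N] = \{0, 1, \dots, N-1\}$. For every integer $k \ge 2$ there exist constants $c > 0$ and $C > 0$, depending only on $k$, such that for all integers $N \ge 1$ the number $A_k(N)$ of $k$-term arithmetic progressions $m, m+d, \dots, m+(k-1)d$ with $d > 0$ contained in $\{ n \in [N] : t(n) = +1 \}$ satisfies $$ \left| A_k(N) - \frac{N^2}{2^{k+1}(k-1)} \right| \le C N^{2-c}. $$ The same holds (with constants again depending only on $k$) for the number of $k$-term arithmetic progressions contained in $\{ n \in [N] : r(n) = +1 \}$. -/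

import Mathlib

/-- The Thue-Morse sequence `t(n) = (-1)^{s₂(n)}`, with `s₂(n)` the sum of the binary digits. -/
def thueMorse (n : ℕ) : ℤ := (-1) ^ (Nat.digits 2 n).sum

/-- The number of (possibly overlapping) occurrences of the pattern `11` in the binary expansion
of `n`. All positions of binary digits equal to `1` are smaller than `n`, as `n < 2 ^ n`. -/
def countOneOne (n : ℕ) : ℕ :=
  ((Finset.range n).filter fun i => n.testBit i = true ∧ n.testBit (i + 1) = true).card

/-- The Rudin-Shapiro sequence `r(n) = (-1)^{f₁₁(n)}`. -/
def rudinShapiro (n : ℕ) : ℤ := (-1) ^ countOneOne n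

/-- The elements `n` of `[N] = {0, 1, …, N - 1}` with `a(n) = +1`. -/
def plusSet (a : ℕ → ℤ) (N : ℕ) : Set ℕ := {n | n < N ∧ a n = 1}

/-- The number of `k`-term arithmetic progressions `m, m + d, …, m + (k - 1) d` with `d > 0` all of
whose terms lie in `S`. For `k ≥ 2` a progression is determined by `(m, d)` and conversely,
and the set of such pairs is finite when `S` is finite. -/
noncomputable def apCount (k : ℕ) (S : Set ℕ) : ℕ :=
  Set.ncard {p : ℕ × ℕ | 0 < p.2 ∧ ∀ i < k, p.1 + i * p.2 ∈ S}

/-!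
Write the indicator of `a(n) = 1` as `(1 + a(n)) / 2` and expand the product over a progression.
The empty product counts all progressions in `[N]`, of which there are
`N ^ 2 / (2 * (k - 1)) + O(N)` (`abs_card_apPairs_sub_le`). It remains to save a power of `N` in
each sum of `∏ i ∈ S, a (m + i * d)` with `S` a nonempty set of indices.

Both sequences are generated by a finite automaton reading binary digits from the lowest one
(`IsBinaryGenerated`). Therefore, if the lowest digits `x`, `y` of `m` and `d` are split off, the
product becomes a sign times a product of the same kind in the high digits, where only the shifts
`r i` caused by the carries and the automaton states `b i` have changed (`apProd_block`); shifts
bounded by `k` stay bounded by `k`. As no such product is constant (`exists_apProd_eq_neg`), for a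
power `Q` of two depending only on `k`, two of the `Q ^ 2` choices of `x, y < Q` lead to the same
product with opposite signs. These cancel, and the sum over a square of side `Q ^ n` is at most
`(Q ^ 2 - 2) ^ n` (`abs_sum_apProd_le`).

Finally the triangle of all `(m, d)` is covered by squares of side about the square root of `N`
(`abs_sum_apPairs_le`), the pairs near the boundary contributing `O(N ^ (3 / 2))`.
-/

/-! ### Signs and finite sums -/

theorem prod_eq_one_or {ι : Type*} (S : Finset ι) (f : ι → ℤ) (hf : ∀ i ∈ S, f i = 1 ∨ f i = -1) :
    ∏ i ∈ S, f i = 1 ∨ ∏ i ∈ S, f i = -1 := by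
  simp_rw [← Int.isUnit_iff] at *
  exact IsUnit.prod_iff.2 hf

theorem sum_range_mul' (q p : ℕ) (f : ℕ → ℤ) :
    ∑ x ∈ Finset.range (q * p), f x =
      ∑ x₀ ∈ Finset.range q, ∑ x ∈ Finset.range p, f (q * x + x₀) := by
  rw [Finset.sum_comm]
  induction p with
  | zero => simp
  | succ p ih => rw [mul_add, mul_one, Finset.sum_range_add, ih, Finset.sum_range_succ]

theorem abs_sum_le_of_add_eq_zero {ι : Type*} [DecidableEq ι] {s : Finset ι} {f : ι → ℤ} {B : ℤ}
    (hB : ∀ i ∈ s, |f i| ≤ B) {p q : ι} (hp : p ∈ s) (hq : q ∈ s) (hpq : p ≠ q)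
    (h : f p + f q = 0) : |∑ i ∈ s, f i| ≤ ((s.card : ℤ) - 2) * B := by
  have hq' : q ∈ s.erase p := Finset.mem_erase.2 ⟨hpq.symm, hq⟩
  rw [← Finset.add_sum_erase s f hp, ← Finset.add_sum_erase _ f hq', ← add_assoc, h, zero_add]
  refine (Finset.abs_sum_le_sum_abs _ _).trans ?_
  refine (Finset.sum_le_card_nsmul _ _ B fun i hi =>
    hB i (Finset.mem_of_mem_erase (Finset.mem_of_mem_erase hi))).trans (le_of_eq ?_)
  have := Finset.card_erase_add_one hq'
  have := Finset.card_erase_add_one hp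
  rw [nsmul_eq_mul]
  congr 1
  omega

/-! ### Products of binary generated sequences along progressions -/

/-- A pair of `±1`-valued sequences `a false`, `a true` generated by the binary digits, read from
the least significant one: `b` records the digit read last, and the digit `e` read next contributes
the sign `a b e`. By `nondegenerate`, the quotient of the sign of `n + 1` after a digit `0` (a carry
occurred) and that of `n` after a digit `1` (no carry) depends on `n`. -/
structure IsBinaryGenerated (a : Bool → ℕ → ℤ) : Prop where
  eq_one_or : ∀ b n, a b n = 1 ∨ a b n = -1
  map_bit : ∀ b e n, a b (2 * n + Bool.toNat e) = a b e.toNat * a e n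
  nondegenerate : a false 1 * a true 0 ≠ a false 2 * a true 1

/-- The product of `a (b i)` over the terms `m + i * d + r i`, `i ∈ S`, of a progression with
shifts `r`. -/
def apProd (a : Bool → ℕ → ℤ) (S : Finset ℕ) (r : ℕ → ℕ) (b : ℕ → Bool) (m d : ℕ) : ℤ :=
  ∏ i ∈ S, a (b i) (m + i * d + r i)

namespace IsBinaryGenerated

variable {a : Bool → ℕ → ℤ}

theorem apProd_eq_one_or (ha : IsBinaryGenerated a) (S : Finset ℕ) (r : ℕ → ℕ) (b : ℕ → Bool)
    (m d : ℕ) : apProd a S r b m d = 1 ∨ apProd a S r b m d = -1 :=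
  prod_eq_one_or S _ fun _ _ => ha.eq_one_or _ _

/-- The bits of `e` act first; only the top one affects the sign of the high digits `n`. -/
theorem map_block (ha : IsBinaryGenerated a) (L : ℕ) (b : Bool) (n e : ℕ) (he : e < 2 ^ (L + 1)) :
    a b (2 ^ (L + 1) * n + e) = a b e * a (decide (2 ^ L ≤ e)) n := by
  induction L generalizing b e with
  | zero =>
    have : e = 0 ∨ e = 1 := by omega
    rcases this with rfl | rfl
    · simpa using ha.map_bit b false n
    · simpa using ha.map_bit b true n
  | succ L ih =>
    obtain ⟨q, c, rfl⟩ : ∃ (q : ℕ) (c : Bool), e = 2 * q + c.toNat := by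
      refine ⟨e / 2, decide (e % 2 = 1), ?_⟩
      rcases Nat.mod_two_eq_zero_or_one e with h | h <;> simp [h] <;> omega
    have hc : c.toNat ≤ 1 := Bool.toNat_le c
    have hq : q < 2 ^ (L + 1) := by rw [pow_succ] at he; omega
    have h1 : 2 ^ (L + 1 + 1) * n + (2 * q + c.toNat) = 2 * (2 ^ (L + 1) * n + q) + c.toNat := by
      ring
    have h2 : (2 ^ (L + 1) ≤ 2 * q + c.toNat) = (2 ^ L ≤ q) := by
      rw [pow_succ, eq_iff_iff]; omega
    rw [h1, ha.map_bit, ih c q hq, ha.map_bit b c q, mul_assoc]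
    simp only [h2]

/-- Splitting off the `L + 1` lowest digits `x`, `y` of `m`, `d` changes the shifts by carries. -/
theorem apProd_block (ha : IsBinaryGenerated a) (S : Finset ℕ) (r : ℕ → ℕ) (b : ℕ → Bool)
    (L m d x y : ℕ) :
    apProd a S r b (2 ^ (L + 1) * m + x) (2 ^ (L + 1) * d + y) =
      (∏ i ∈ S, a (b i) ((x + i * y + r i) % 2 ^ (L + 1))) *
        apProd a S (fun i => (x + i * y + r i) / 2 ^ (L + 1))
          (fun i => decide (2 ^ L ≤ (x + i * y + r i) % 2 ^ (L + 1))) m d := by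
  unfold apProd
  rw [← Finset.prod_mul_distrib]
  refine Finset.prod_congr rfl fun i _ => ?_
  rw [← ha.map_block L _ _ _ (Nat.mod_lt _ (by positivity))]
  congr 1
  have := Nat.div_add_mod (x + i * y + r i) (2 ^ (L + 1))
  beta_reduce
  generalize (x + i * y + r i) / 2 ^ (L + 1) = u at *
  generalize (x + i * y + r i) % 2 ^ (L + 1) = v at *
  linear_combination -this

/-- Without carries, and with leading digit zero, the state is reset to the trivial one. -/
theorem apProd_block_of_small (ha : IsBinaryGenerated a) (S : Finset ℕ) (r : ℕ → ℕ)
    (b : ℕ → Bool) (L m d x y : ℕ) (h : ∀ i ∈ S, x + i * y + r i < 2 ^ L) :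
    apProd a S r b (2 ^ (L + 1) * m + x) (2 ^ (L + 1) * d + y) =
      apProd a S r b x y * apProd a S 0 (fun _ => false) m d := by
  rw [ha.apProd_block]
  unfold apProd
  congr 1 <;> refine Finset.prod_congr rfl fun i hi => ?_ <;> have hi := h i hi <;>
    have hi' : x + i * y + r i < 2 ^ (L + 1) := by rw [pow_succ]; omega
  · rw [Nat.mod_eq_of_lt hi']
  · beta_reduce
    rw [Nat.mod_eq_of_lt hi', Nat.div_eq_of_lt hi', decide_eq_false hi.not_ge]
    simp

/-- The products `apProd a S r b` are not constant. With `j = max S`, two choices of the low digits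
that differ by one keep the terms with `i < j` in the upper half below a power of two, while the
term `j` is just below that power in one case and equal to it in the other. The step `k + 1` exceeds
all shifts, so that the terms are increasing in `i`. The quotient is then
`± a false (n + 1) * a true n`, which depends on the high digits `n`. -/
theorem exists_apProd_eq_neg (ha : IsBinaryGenerated a) {k : ℕ} {S : Finset ℕ} (hS : S.Nonempty)
    (hSk : ∀ i ∈ S, i < k) {r : ℕ → ℕ} (hr : ∀ i ∈ S, r i ≤ k) (b : ℕ → Bool) :
    ∃ x ≤ 2 ^ ((k + 1) ^ 2 + 2), ∃ x' ≤ 2 ^ ((k + 1) ^ 2 + 2),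
      apProd a S r b x (k + 1) = -apProd a S r b x' (k + 1) := by
  set L := (k + 1) ^ 2 with hL
  have hpow : L < 2 ^ L := Nat.lt_two_pow_self
  set j := S.max' hS with hj
  have hjS : j ∈ S := S.max'_mem hS
  have hjk := hSk j hjS
  have hrj := hr j hjS
  have hjy : j * (k + 1) ≤ (k - 1) * (k + 1) := Nat.mul_le_mul_right _ (by omega)
  have hkk : (k - 1) * (k + 1) + 2 * (k + 1) = L := by
    obtain ⟨l, rfl⟩ : ∃ l, k = l + 1 := ⟨k - 1, by omega⟩
    simp only [hL, Nat.add_sub_cancel]; ring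
  -- the low digits `z + 1` and `z` put the term `j` at `2 ^ (L + 1)` and just below it
  obtain ⟨z, hz⟩ : ∃ z, z + 1 + j * (k + 1) + r j = 2 ^ (L + 1) :=
    ⟨2 ^ (L + 1) - 1 - j * (k + 1) - r j, by rw [pow_succ]; omega⟩
  have hlow : ∀ i ∈ S, i ≠ j → z + 1 + i * (k + 1) + r i < 2 ^ (L + 1) ∧
      2 ^ L < z + 1 + i * (k + 1) + r i := by
    intro i hi hij
    have hij : i + 1 ≤ j := lt_of_le_of_ne (S.le_max' i hi) hij
    have h1 := Nat.mul_le_mul_right (k + 1) hij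
    have h2 := hr i hi
    rw [add_mul, one_mul] at h1
    rw [pow_succ] at hz ⊢
    omega
  have hA : ∀ n, apProd a S r b (2 ^ (L + 1) * n + (z + 1)) (k + 1) =
      (∏ i ∈ S, a (b i) ((z + 1 + i * (k + 1) + r i) % 2 ^ (L + 1))) *
        (a false (n + 1) * ∏ i ∈ S.erase j, a true n) := by
    intro n
    have := ha.apProd_block S r b L n 0 (z + 1) (k + 1)
    rw [mul_zero, zero_add] at this
    rw [this]
    congr 1
    unfold apProd
    rw [← Finset.mul_prod_erase S _ hjS]
    congr 1
    · simp [hz]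
    · refine Finset.prod_congr rfl fun i hi => ?_
      obtain ⟨h1, h2⟩ := hlow i (Finset.mem_of_mem_erase hi) (Finset.ne_of_mem_erase hi)
      beta_reduce
      rw [Nat.mod_eq_of_lt h1, Nat.div_eq_of_lt h1]
      simp [h2.le]
  have hB : ∀ n, apProd a S r b (2 ^ (L + 1) * n + z) (k + 1) =
      (∏ i ∈ S, a (b i) ((z + i * (k + 1) + r i) % 2 ^ (L + 1))) *
        (a true n * ∏ i ∈ S.erase j, a true n) := by
    intro n
    have := ha.apProd_block S r b L n 0 z (k + 1)
    rw [mul_zero, zero_add] at this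
    rw [this, Finset.mul_prod_erase S (fun _ => a true n) hjS]
    congr 1
    refine Finset.prod_congr rfl fun i hi => ?_
    have h12 : z + i * (k + 1) + r i < 2 ^ (L + 1) ∧ 2 ^ L ≤ z + i * (k + 1) + r i := by
      by_cases hij : i = j
      · rw [hij]; rw [pow_succ] at hz ⊢; omega
      · have := hlow i hi hij; omega
    beta_reduce
    rw [Nat.mod_eq_of_lt h12.1, Nat.div_eq_of_lt h12.1]
    simp [h12.2]
  have hε := prod_eq_one_or S (fun i => a (b i) ((z + 1 + i * (k + 1) + r i) % 2 ^ (L + 1)))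
    fun _ _ => ha.eq_one_or _ _
  have hε' := prod_eq_one_or S (fun i => a (b i) ((z + i * (k + 1) + r i) % 2 ^ (L + 1)))
    fun _ _ => ha.eq_one_or _ _
  have hP : ∀ n, _ := fun n => prod_eq_one_or (S.erase j) (fun _ => a true n)
    fun _ _ => ha.eq_one_or _ _
  have hbd : z + 1 ≤ 2 ^ (L + 1) := by omega
  have hQ : 2 ^ (L + 2) = 2 * 2 ^ (L + 1) := by ring
  by_contra! hne
  have key : ∀ n < 2, apProd a S r b (2 ^ (L + 1) * n + (z + 1)) (k + 1) *
      apProd a S r b (2 ^ (L + 1) * n + z) (k + 1) = 1 := by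
    intro n hn
    have hn : 2 ^ (L + 1) * n ≤ 2 ^ (L + 1) * 1 := Nat.mul_le_mul_left _ (by omega)
    have := hne (2 ^ (L + 1) * n + (z + 1)) (by omega) (2 ^ (L + 1) * n + z) (by omega)
    rcases ha.apProd_eq_one_or S r b (2 ^ (L + 1) * n + (z + 1)) (k + 1) with h | h <;>
      rcases ha.apProd_eq_one_or S r b (2 ^ (L + 1) * n + z) (k + 1) with h' | h' <;>
        rw [h, h'] at this ⊢ <;> simp_all
  have hval : ∀ n < 2, a false (n + 1) * a true n =
      (∏ i ∈ S, a (b i) ((z + 1 + i * (k + 1) + r i) % 2 ^ (L + 1))) *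
        ∏ i ∈ S, a (b i) ((z + i * (k + 1) + r i) % 2 ^ (L + 1)) := by
    intro n hn
    have h := key n hn
    rw [hA, hB] at h
    generalize (∏ i ∈ S, a (b i) ((z + 1 + i * (k + 1) + r i) % 2 ^ (L + 1))) = u at *
    generalize (∏ i ∈ S, a (b i) ((z + i * (k + 1) + r i) % 2 ^ (L + 1))) = v at *
    have hPn := hP n
    generalize (∏ i ∈ S.erase j, a true n) = w at *
    rcases hε with rfl | rfl <;> rcases hε' with rfl | rfl <;> rcases hPn with rfl | rfl <;>
      linarith
  exact ha.nondegenerate ((hval 0 (by norm_num)).trans (hval 1 (by norm_num)).symm)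

/-- The sum of `apProd` over a square of side `Q ^ n`, for a power `Q` of two depending on `k` only,
gains a factor `1 - 2 / Q ^ 2` with each of the `n` groups of digits: among the `Q ^ 2` choices of
the lowest group of digits, two lead to the same product with opposite signs. The exponent
in `Q` leaves room for the digits from `exists_apProd_eq_neg` to be followed by a digit zero without
carries. -/
theorem abs_sum_apProd_le (ha : IsBinaryGenerated a) {k : ℕ} {S : Finset ℕ} (hS : S.Nonempty)
    (hSk : ∀ i ∈ S, i < k) {Q : ℕ} (hQ : Q = 2 ^ ((k + 1) ^ 2 + 4)) (n : ℕ) {r : ℕ → ℕ}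
    (hr : ∀ i ∈ S, r i ≤ k) (b : ℕ → Bool) (m d : ℕ) :
    |∑ x ∈ Finset.range (Q ^ n), ∑ y ∈ Finset.range (Q ^ n),
      apProd a S r b (Q ^ n * m + x) (Q ^ n * d + y)| ≤ ((Q : ℤ) ^ 2 - 2) ^ n := by
  induction n generalizing r b with
  | zero =>
    rcases ha.apProd_eq_one_or S r b m d with h | h <;> simp [h]
  | succ n ih =>
    set L := (k + 1) ^ 2 + 3 with hL
    have hQ : Q = 2 ^ (L + 1) := hQ
    have hsplit : ∑ x ∈ Finset.range (Q ^ (n + 1)), ∑ y ∈ Finset.range (Q ^ (n + 1)),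
        apProd a S r b (Q ^ (n + 1) * m + x) (Q ^ (n + 1) * d + y) =
        ∑ p ∈ Finset.range Q ×ˢ Finset.range Q,
          ∑ x ∈ Finset.range (Q ^ n), ∑ y ∈ Finset.range (Q ^ n),
            apProd a S r b (Q * (Q ^ n * m + x) + p.1) (Q * (Q ^ n * d + y) + p.2) := by
      rw [pow_succ', sum_range_mul', Finset.sum_product]
      refine Finset.sum_congr rfl fun x₀ _ => ?_
      simp_rw [sum_range_mul' Q (Q ^ n) fun y => apProd a S r b _ (Q * Q ^ n * d + y)]
      rw [Finset.sum_comm]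
      refine Finset.sum_congr rfl fun y₀ _ => Finset.sum_congr rfl fun x _ =>
        Finset.sum_congr rfl fun y _ => ?_
      congr 1 <;> ring
    have hbound : ∀ p ∈ Finset.range Q ×ˢ Finset.range Q,
        |∑ x ∈ Finset.range (Q ^ n), ∑ y ∈ Finset.range (Q ^ n),
          apProd a S r b (Q * (Q ^ n * m + x) + p.1) (Q * (Q ^ n * d + y) + p.2)| ≤
          ((Q : ℤ) ^ 2 - 2) ^ n := by
      rintro ⟨x₀, y₀⟩ hp
      simp only [Finset.mem_product, Finset.mem_range] at hp ⊢
      simp_rw [hQ, ha.apProd_block, ← hQ, ← Finset.mul_sum]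
      have h1 := prod_eq_one_or S (fun i => a (b i) ((x₀ + i * y₀ + r i) % Q))
        fun _ _ => ha.eq_one_or _ _
      rw [abs_mul, show |_| = (1 : ℤ) by rcases h1 with h1 | h1 <;> rw [h1] <;> rfl, one_mul]
      refine ih (fun i hi => ?_) _
      have hi := hSk i hi
      have hri := hr i ‹_›
      rw [← Nat.lt_add_one_iff, Nat.div_lt_iff_lt_mul (by omega)]
      have h2 : i * y₀ ≤ (k - 1) * Q := Nat.mul_le_mul (by omega) hp.2.le
      have h3 : (k - 1) * Q + 2 * Q = (k + 1) * Q := by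
        obtain ⟨l, rfl⟩ : ∃ l, k = l + 1 := ⟨k - 1, by omega⟩
        simp only [Nat.add_sub_cancel]; ring
      have h4 : k < Q := by
        have : L + 1 < 2 ^ (L + 1) := Nat.lt_two_pow_self
        have : k + 1 ≤ (k + 1) ^ 2 := Nat.le_self_pow (by norm_num) _
        omega
      omega
    obtain ⟨x, hx, x', hx', hneg⟩ := ha.exists_apProd_eq_neg hS hSk hr b
    have hk1 : k + 1 ≤ (k + 1) ^ 2 := Nat.le_self_pow (by norm_num) _
    have hk2 : (k + 1) ^ 2 < 2 ^ (k + 1) ^ 2 := Nat.lt_two_pow_self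
    have hQ4 : 2 ^ ((k + 1) ^ 2 + 2) = 4 * 2 ^ (k + 1) ^ 2 := by ring
    have hL8 : 2 ^ L = 8 * 2 ^ (k + 1) ^ 2 := by rw [hL]; ring
    have hQL : Q = 2 * 2 ^ L := by rw [hQ]; ring
    have hsmall : ∀ x ≤ 2 ^ ((k + 1) ^ 2 + 2), ∀ i ∈ S, x + i * (k + 1) + r i < 2 ^ L := by
      intro x hx i hi
      have h1 : i * (k + 1) ≤ k * (k + 1) := Nat.mul_le_mul_right _ (hSk i hi).le
      have h2 : k * (k + 1) + (k + 1) = (k + 1) ^ 2 := by ring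
      have h3 := hr i hi
      omega
    rw [hsplit, pow_succ']
    have hcard : ((Finset.range Q ×ˢ Finset.range Q).card : ℤ) = (Q : ℤ) ^ 2 := by
      simp [sq]
    rw [← hcard]
    rw [← hcard] at hbound
    refine abs_sum_le_of_add_eq_zero hbound (p := (x, k + 1)) (q := (x', k + 1)) ?_ ?_ ?_ ?_
    · simp only [Finset.mem_product, Finset.mem_range]; omega
    · simp only [Finset.mem_product, Finset.mem_range]; omega
    · intro h
      rw [(Prod.mk.inj h).1] at hneg
      rcases ha.apProd_eq_one_or S r b x' (k + 1) with h | h <;> rw [h] at hneg <;> norm_num at hneg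
    · simp_rw [hQ, ha.apProd_block_of_small S r b L _ _ x (k + 1) (hsmall x hx),
        ha.apProd_block_of_small S r b L _ _ x' (k + 1) (hsmall x' hx'), hneg, neg_mul,
        Finset.sum_neg_distrib]
      exact neg_add_cancel _

end IsBinaryGenerated

/-! ### The Thue-Morse and Rudin-Shapiro sequences -/

/-- The Rudin-Shapiro sequence, twisted by `(-1) ^ n` after a digit `1`. -/
def rudinShapiroPair (b : Bool) (n : ℕ) : ℤ := (-1) ^ (b.toNat * n) * rudinShapiro n

theorem thueMorse_bit (c : Bool) (n : ℕ) :
    thueMorse (2 * n + c.toNat) = thueMorse c.toNat * thueMorse n := by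
  unfold thueMorse
  cases c
  · rcases Nat.eq_zero_or_pos n with rfl | hn
    · simp
    · simp [Nat.digits_def' (b := 2) one_lt_two (n := 2 * n) (by omega)]
  · rw [Bool.toNat_true, add_comm, Nat.digits_add_two_add_one]
    simp [pow_add, show (1 + 2 * n) / 2 = n by omega, Nat.add_mul_mod_self_left]

theorem isBinaryGenerated_thueMorse : IsBinaryGenerated fun _ => thueMorse where
  eq_one_or _ _ := neg_one_pow_eq_or _ _
  map_bit _ c n := thueMorse_bit c n
  nondegenerate := by simp [thueMorse]

theorem countOneOne_eq_sum {n M : ℕ} (h : n ≤ M) :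
    countOneOne n = ∑ i ∈ Finset.range M, (n.testBit i && n.testBit (i + 1)).toNat := by
  unfold countOneOne
  rw [Finset.card_filter, ← Finset.sum_subset (Finset.range_subset_range.2 h)]
  · refine Finset.sum_congr rfl fun i _ => ?_
    cases n.testBit i <;> cases n.testBit (i + 1) <;> rfl
  · intro i _ hi
    rw [Finset.mem_range, not_lt] at hi
    rw [Nat.testBit_lt_two_pow (hi.trans_lt Nat.lt_two_pow_self)]
    rfl

theorem countOneOne_bit (c : Bool) (n : ℕ) :
    countOneOne (2 * n + c.toNat) = countOneOne n + (c && n.testBit 0).toNat := by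
  have hc := Bool.toNat_le c
  have h0 : (2 * n + c.toNat).testBit 0 = c := by
    cases c <;> simp [Nat.testBit_zero]
  have hs : ∀ i, (2 * n + c.toNat).testBit (i + 1) = n.testBit i := by
    intro i
    rw [Nat.testBit_succ]
    congr 1
    omega
  rw [countOneOne_eq_sum (show 2 * n + c.toNat ≤ 2 * n + 1 by omega),
    countOneOne_eq_sum (show n ≤ 2 * n by omega), Finset.sum_range_succ']
  simp only [hs, h0]

theorem rudinShapiro_bit (c : Bool) (n : ℕ) :
    rudinShapiro (2 * n + c.toNat) = (-1) ^ (c.toNat * n) * rudinShapiro n := by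
  unfold rudinShapiro
  rw [countOneOne_bit, pow_add, mul_comm]
  congr 1
  cases c
  · simp
  · rcases Nat.even_or_odd n with h | h
    · simp [Nat.testBit_zero, Nat.even_iff.1 h, h.neg_one_pow]
    · simp [Nat.testBit_zero, Nat.odd_iff.1 h, h.neg_one_pow]

theorem isBinaryGenerated_rudinShapiroPair : IsBinaryGenerated rudinShapiroPair where
  eq_one_or b n := by
    unfold rudinShapiroPair rudinShapiro
    rw [← pow_add]
    exact neg_one_pow_eq_or _ _
  map_bit b c n := by
    have h1 : ∀ c : Bool, rudinShapiro c.toNat = 1 := by decide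
    unfold rudinShapiroPair
    rw [rudinShapiro_bit, h1, mul_add, pow_add, show b.toNat * (2 * n) = 2 * (b.toNat * n) by ring,
      pow_mul]
    simp
  nondegenerate := by decide

/-! ### Progressions in an interval and squares of pairs -/

/-- The pairs `(m, d)` for which `m, m + d, …, m + (k - 1) * d` is a progression in `[N]`, `d > 0`
(for `k ≥ 2`). -/
def apPairs (k N : ℕ) : Finset (ℕ × ℕ) :=
  (Finset.range N ×ˢ Finset.range N).filter fun p => 0 < p.2 ∧ p.1 + (k - 1) * p.2 < N

theorem mem_apPairs {k N : ℕ} (hk : 2 ≤ k) {p : ℕ × ℕ} :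
    p ∈ apPairs k N ↔ 0 < p.2 ∧ p.1 + (k - 1) * p.2 < N := by
  unfold apPairs
  simp only [Finset.mem_filter, Finset.mem_product, Finset.mem_range, and_iff_right_iff_imp]
  rintro ⟨-, h⟩
  have : 1 * p.2 ≤ (k - 1) * p.2 := Nat.mul_le_mul_right _ (by omega)
  omega

/-- Progressions are counted by their last term `n`, each `n` being the last term of
`n / (k - 1)` of them. -/
theorem card_apPairs {k : ℕ} (hk : 2 ≤ k) (N : ℕ) :
    (apPairs k N).card = ∑ n ∈ Finset.range N, n / (k - 1) := by
  rw [Finset.card_eq_sum_card_fiberwise (f := fun p : ℕ × ℕ => p.1 + (k - 1) * p.2)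
    (t := Finset.range N) fun p hp => by
      simpa using ((mem_apPairs hk).1 hp).2]
  refine Finset.sum_congr rfl fun n hn => ?_
  rw [Finset.mem_range] at hn
  have hk1 : 0 < k - 1 := by omega
  conv_rhs => rw [← Nat.add_sub_cancel (n := n / (k - 1)) (m := 1), ← Nat.card_Icc]
  refine Finset.card_nbij' (fun p => p.2) (fun d => (n - (k - 1) * d, d)) ?_ ?_ ?_ ?_
  · intro p hp
    simp only [Finset.coe_filter, mem_apPairs hk, Set.mem_ofPred_eq, Finset.coe_Icc,
      Set.mem_Icc] at hp ⊢
    refine ⟨hp.1.1, (Nat.le_div_iff_mul_le hk1).2 ?_⟩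
    rw [mul_comm]; omega
  · intro d hd
    simp only [Finset.coe_filter, mem_apPairs hk, Set.mem_ofPred_eq, Finset.coe_Icc,
      Set.mem_Icc] at hd ⊢
    have := (Nat.le_div_iff_mul_le hk1).1 hd.2
    rw [mul_comm] at this
    omega
  · rintro ⟨m, d⟩ hp
    simp only [Finset.coe_filter, mem_apPairs hk, Set.mem_ofPred_eq] at hp ⊢
    ext
    · simp only; omega
    · rfl
  · intro d _
    rfl

theorem abs_card_apPairs_sub_le {k : ℕ} (hk : 2 ≤ k) (N : ℕ) :
    |((apPairs k N).card : ℝ) - (N : ℝ) ^ 2 / (2 * ((k : ℝ) - 1))| ≤ 2 * (N : ℝ) := by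
  have hk' : (2 : ℝ) ≤ k := by exact_mod_cast hk
  have hcast : ((k - 1 : ℕ) : ℝ) = (k : ℝ) - 1 := by
    rw [Nat.cast_sub (by omega), Nat.cast_one]
  have hK : (1 : ℝ) ≤ (k : ℝ) - 1 := by linarith
  rw [card_apPairs hk]
  induction N with
  | zero => simp
  | succ N ih =>
    rw [Finset.sum_range_succ, Nat.cast_add, Nat.cast_succ]
    have h1 : ((N / (k - 1) : ℕ) : ℝ) ≤ N / ((k : ℝ) - 1) := hcast ▸ Nat.cast_div_le
    have h2 : (N : ℝ) / ((k : ℝ) - 1) < ((N / (k - 1) : ℕ) : ℝ) + 1 := by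
      rw [div_lt_iff₀ (by linarith), ← hcast]
      exact_mod_cast (Nat.div_lt_iff_lt_mul (by omega)).1 (Nat.lt_succ_self (N / (k - 1)))
    have h3 : ((N : ℝ) + 1) ^ 2 / (2 * ((k : ℝ) - 1)) =
        (N : ℝ) ^ 2 / (2 * ((k : ℝ) - 1)) + N / ((k : ℝ) - 1) + 1 / (2 * ((k : ℝ) - 1)) := by
      field_simp; ring
    have h4 : 1 / (2 * ((k : ℝ) - 1)) ≤ 1 := by
      rw [div_le_one (by linarith)]; linarith
    have h5 : 0 ≤ 1 / (2 * ((k : ℝ) - 1)) := by positivity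
    rw [abs_le] at ih ⊢
    constructor <;> linarith

/-- The corners, in units of `Q`, of squares of side `Q` of the grid which lie in `apPairs k N`. The
last condition is `Q * (m + 1) + (k - 1) * (Q * (d + 1)) ≤ N`, at the opposite corner. -/
def apCorners (k N Q : ℕ) : Finset (ℕ × ℕ) :=
  (Finset.range (N / Q) ×ˢ Finset.range (N / Q)).filter fun p =>
    0 < p.2 ∧ Q * p.1 + (k - 1) * (Q * p.2) + k * Q ≤ N

/-- The sum over all progressions is the sum over squares of side `Q`, up to the `O(k N Q)` pairs
near the boundary of the triangle `apPairs k N`. -/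
theorem abs_sum_apPairs_le {k N Q : ℕ} (hk : 2 ≤ k) (hQ : 0 < Q) (f : ℕ → ℕ → ℤ)
    (hf : ∀ m d, |f m d| ≤ 1) {B : ℤ}
    (hB : ∀ m d, |∑ x ∈ Finset.range Q, ∑ y ∈ Finset.range Q, f (Q * m + x) (Q * d + y)| ≤ B) :
    |∑ p ∈ apPairs k N, f p.1 p.2| ≤ ((N / Q : ℕ) : ℤ) ^ 2 * B + (k + 1) * N * Q := by
  have hB0 : 0 ≤ B := (abs_nonneg _).trans (hB 0 0)
  -- `G` is the union of the squares, `D` the part near the boundary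
  set G := (apPairs k N).filter fun p => (p.1 / Q, p.2 / Q) ∈ apCorners k N Q with hG
  set D := (apPairs k N).filter fun p => (p.1 / Q, p.2 / Q) ∉ apCorners k N Q with hD
  have hsum : ∑ p ∈ apPairs k N, f p.1 p.2 = ∑ p ∈ G, f p.1 p.2 + ∑ p ∈ D, f p.1 p.2 :=
    (Finset.sum_filter_add_sum_filter_not _ _ _).symm
  have hGsum : ∑ p ∈ G, f p.1 p.2 = ∑ p ∈ apCorners k N Q,
      ∑ x ∈ Finset.range Q, ∑ y ∈ Finset.range Q, f (Q * p.1 + x) (Q * p.2 + y) := by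
    have hprod : ∀ p : ℕ × ℕ,
        ∑ x ∈ Finset.range Q, ∑ y ∈ Finset.range Q, f (Q * p.1 + x) (Q * p.2 + y) =
          ∑ q ∈ Finset.range Q ×ˢ Finset.range Q, f (Q * p.1 + q.1) (Q * p.2 + q.2) := fun p =>
      (Finset.sum_product' _ _ fun x y => f (Q * p.1 + x) (Q * p.2 + y)).symm
    rw [Finset.sum_congr rfl fun p _ => hprod p, ← Finset.sum_product' _ _
      fun (p q : ℕ × ℕ) => f (Q * p.1 + q.1) (Q * p.2 + q.2)]
    refine Finset.sum_nbij' (fun p => ((p.1 / Q, p.2 / Q), (p.1 % Q, p.2 % Q)))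
      (fun q => (Q * q.1.1 + q.2.1, Q * q.1.2 + q.2.2)) ?_ ?_ ?_ ?_ ?_
    · intro p hp
      simp only [hG, Finset.mem_filter] at hp
      simp only [Finset.mem_product, Finset.mem_range]
      exact ⟨hp.2, Nat.mod_lt _ hQ, Nat.mod_lt _ hQ⟩
    · rintro ⟨⟨m, d⟩, ⟨x, y⟩⟩ hq
      simp only [Finset.mem_product, Finset.mem_range] at hq
      obtain ⟨hc, hx, hy⟩ := hq
      simp only [hG, Finset.mem_filter, mem_apPairs hk, Nat.mul_add_div hQ, Nat.div_eq_of_lt hx,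
        Nat.div_eq_of_lt hy, add_zero]
      refine ⟨?_, hc⟩
      simp only [apCorners, Finset.mem_filter] at hc
      have h1 : 0 < Q * d := Nat.mul_pos hQ hc.2.1
      have h2 : (k - 1) * y ≤ (k - 1) * Q := Nat.mul_le_mul_left _ hy.le
      have h3 : (k - 1) * Q + Q = k * Q := by
        rw [← Nat.succ_mul, Nat.succ_eq_add_one, Nat.sub_add_cancel (by omega)]
      rw [mul_add]
      omega
    · intro p _
      simp [Nat.div_add_mod]
    · rintro ⟨⟨m, d⟩, ⟨x, y⟩⟩ hq
      simp only [Finset.mem_product, Finset.mem_range] at hq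
      simp [Nat.mul_add_div hQ, Nat.div_eq_of_lt hq.2.1, Nat.div_eq_of_lt hq.2.2,
        Nat.mod_eq_of_lt hq.2.1, Nat.mod_eq_of_lt hq.2.2]
    · intro p _
      simp [Nat.div_add_mod]
  have hGle : |∑ p ∈ G, f p.1 p.2| ≤ ((N / Q : ℕ) : ℤ) ^ 2 * B := by
    rw [hGsum]
    refine (Finset.abs_sum_le_sum_abs _ _).trans ?_
    refine (Finset.sum_le_card_nsmul _ _ B fun p _ => hB p.1 p.2).trans ?_
    rw [nsmul_eq_mul]
    refine mul_le_mul_of_nonneg_right ?_ hB0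
    have := Finset.card_filter_le (Finset.range (N / Q) ×ˢ Finset.range (N / Q))
      fun p => 0 < p.2 ∧ Q * p.1 + (k - 1) * (Q * p.2) + k * Q ≤ N
    rw [Finset.card_product, Finset.card_range, ← sq] at this
    exact_mod_cast this
  have hDcard : D.card ≤ (k + 1) * N * Q := by
    -- outside the squares, either `d < Q` or the last term is within `k * Q` of `N`
    have hsub : D ⊆ (Finset.range N ×ˢ Finset.range Q) ∪
        (Finset.range N).biUnion fun d => (Finset.Ico (N - (k - 1) * d - k * Q)
          (N - (k - 1) * d)).image fun m => (m, d) := by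
      rintro ⟨m, d⟩ hp
      simp only [hD, Finset.mem_filter] at hp
      obtain ⟨hp, hc⟩ := hp
      have hpr := Finset.mem_product.1 (Finset.mem_filter.1 hp).1
      simp only [Finset.mem_range] at hpr
      rw [mem_apPairs hk] at hp
      simp only [Finset.mem_union, Finset.mem_product, Finset.mem_range, Finset.mem_biUnion,
        Finset.mem_image, Finset.mem_Ico, Prod.mk.injEq]
      by_contra! hcon
      obtain ⟨h1, h2⟩ := hcon
      have hdQ := h1 hpr.1
      have h3 : m + (k - 1) * d + k * Q < N := by
        by_contra! h
        simp only at hp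
        exact h2 d hpr.2 m (by omega) rfl rfl
      apply hc
      have e1 : Q * (m / Q) ≤ m := Nat.mul_div_le m Q
      have e2 : Q * (d / Q) ≤ d := Nat.mul_div_le d Q
      have e3 := Nat.mul_le_mul_left (k - 1) e2
      have e4 : 1 * d ≤ (k - 1) * d := Nat.mul_le_mul_right _ (by omega)
      have e5 : 1 * Q ≤ k * Q := Nat.mul_le_mul_right _ (by omega)
      simp only [apCorners, Finset.mem_filter, Finset.mem_product, Finset.mem_range]
      refine ⟨⟨?_, ?_⟩, Nat.div_pos hdQ hQ, by omega⟩ <;>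
        rw [Nat.lt_iff_add_one_le, Nat.le_div_iff_mul_le hQ, mul_comm, mul_add] <;> omega
    refine (Finset.card_le_card hsub).trans ((Finset.card_union_le _ _).trans ?_)
    rw [Finset.card_product, Finset.card_range, Finset.card_range]
    have hbi : ((Finset.range N).biUnion fun d => (Finset.Ico (N - (k - 1) * d - k * Q)
          (N - (k - 1) * d)).image fun m => (m, d)).card ≤ N * (k * Q) := by
      refine (Finset.card_biUnion_le_card_mul _ _ (k * Q) fun d _ => ?_).trans (by simp)
      refine Finset.card_image_le.trans ?_
      rw [Nat.card_Ico]
      omega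
    calc N * Q + _ ≤ N * Q + N * (k * Q) := Nat.add_le_add_left hbi _
      _ = (k + 1) * N * Q := by ring
  have hDle : |∑ p ∈ D, f p.1 p.2| ≤ (k + 1) * N * Q := by
    refine (Finset.abs_sum_le_sum_abs _ _).trans ?_
    refine (Finset.sum_le_card_nsmul _ _ 1 fun p _ => hf p.1 p.2).trans ?_
    rw [nsmul_eq_mul, mul_one]
    exact_mod_cast hDcard
  rw [hsum]
  exact (abs_add_le _ _).trans (add_le_add hGle hDle)

/-! ### Power saving and the count of progressions -/

/-- The correlations of a binary generated sequence along progressions have a power saving. -/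
theorem IsBinaryGenerated.exists_abs_sum_le {a : Bool → ℕ → ℤ} (ha : IsBinaryGenerated a) {k : ℕ}
    (hk : 2 ≤ k) : ∃ c : ℝ, 0 < c ∧ c ≤ 1 / 2 ∧ ∃ C : ℝ, 0 < C ∧ ∀ N : ℕ, 1 ≤ N →
      ∀ S ⊆ Finset.range k, S.Nonempty →
        |(∑ p ∈ apPairs k N, ∏ i ∈ S, (a false (p.1 + i * p.2) : ℝ))| ≤ C * (N : ℝ) ^ (2 - c) := by
  obtain ⟨Q, hQ⟩ : ∃ Q, Q = 2 ^ ((k + 1) ^ 2 + 4) := ⟨_, rfl⟩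
  have hQ4 : 4 ≤ Q := hQ ▸ Nat.pow_le_pow_right (n := 2) (by norm_num) (by omega : 2 ≤ _)
  have hQR : (4 : ℝ) ≤ Q := by exact_mod_cast hQ4
  have hQ2 : (16 : ℝ) ≤ (Q : ℝ) ^ 2 := by nlinarith
  set ρ : ℝ := ((Q : ℝ) ^ 2 - 2) / (Q : ℝ) ^ 2 with hρ
  have hρ0 : 0 < ρ := div_pos (by linarith) (by linarith)
  have hρ1 : ρ < 1 := (div_lt_one (by linarith)).2 (by linarith)
  -- the exponent for which `ρ = (Q ^ 2) ^ (-c₀)`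
  set c₀ : ℝ := -Real.logb ((Q : ℝ) ^ 2) ρ with hc₀
  have hc₀0 : 0 < c₀ := neg_pos.2 (Real.logb_neg (by linarith) hρ0 hρ1)
  have hρc : ((Q : ℝ) ^ 2) ^ (-c₀) = ρ := by
    rw [hc₀, neg_neg, Real.rpow_logb (by linarith) (by linarith) hρ0]
  refine ⟨min c₀ (1 / 2), lt_min hc₀0 (by norm_num), min_le_right _ _, ρ⁻¹ + (k + 1), by positivity,
    fun N hN S hSk hS => ?_⟩
  have hN1 : (1 : ℝ) ≤ N := by exact_mod_cast hN
  have hN0 : (0 : ℝ) < N := by linarith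
  -- squares of side `Q ^ n`, about the square root of `N`
  set n := Nat.log (Q ^ 2) N with hn
  have hQn : (Q ^ 2) ^ n ≤ N := Nat.pow_log_le_self _ (by omega)
  have hNQ : N < (Q ^ 2) ^ (n + 1) := Nat.lt_pow_succ_log_self (by nlinarith) _
  have hblock := abs_sum_apPairs_le (N := N) hk (pow_pos (by omega : 0 < Q) n)
    (apProd a S 0 fun _ => false)
    (fun m d => by rcases ha.apProd_eq_one_or S 0 (fun _ => false) m d with h | h <;> simp [h])
    (fun m d => ha.abs_sum_apProd_le hS (fun i hi => Finset.mem_range.1 (hSk hi)) hQ n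
      (r := 0) (by simp) _ m d)
  have hblock' : |(∑ p ∈ apPairs k N, ∏ i ∈ S, (a false (p.1 + i * p.2) : ℝ))| ≤
      ((N / Q ^ n : ℕ) : ℝ) ^ 2 * ((Q : ℝ) ^ 2 - 2) ^ n + (k + 1) * N * (Q : ℝ) ^ n := by
    simp only [apProd, Pi.zero_apply, add_zero] at hblock
    generalize N / Q ^ n = u at *
    have := (Int.cast_le (R := ℝ)).2 hblock
    push_cast at this
    exact this
  have hmain : ((N / Q ^ n : ℕ) : ℝ) ^ 2 * ((Q : ℝ) ^ 2 - 2) ^ n ≤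
      ρ⁻¹ * (N : ℝ) ^ (2 - min c₀ (1 / 2)) := by
    have h1 : ((N / Q ^ n : ℕ) : ℝ) ≤ N / (Q : ℝ) ^ n := by exact_mod_cast Nat.cast_div_le
    have h2 : ((N / Q ^ n : ℕ) : ℝ) ^ 2 * ((Q : ℝ) ^ 2 - 2) ^ n ≤ (N : ℝ) ^ 2 * ρ ^ n := by
      have : (0 : ℝ) ≤ ((Q : ℝ) ^ 2 - 2) ^ n := pow_nonneg (by linarith) _
      calc _ ≤ (N / (Q : ℝ) ^ n) ^ 2 * ((Q : ℝ) ^ 2 - 2) ^ n := by gcongr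
        _ = (N : ℝ) ^ 2 * ρ ^ n := by
          rw [hρ, div_pow, div_pow, ← pow_mul, ← pow_mul, mul_comm n 2]; ring
    have h3 : ρ ^ (n + 1) ≤ (N : ℝ) ^ (-c₀) := by
      rw [← hρc, ← Real.rpow_natCast, ← Real.rpow_mul (by positivity), mul_comm,
        Real.rpow_mul (by positivity), Real.rpow_natCast]
      refine Real.rpow_le_rpow_of_nonpos hN0 ?_ (by linarith)
      exact_mod_cast hNQ.le
    have h4 : ρ ^ n ≤ ρ⁻¹ * (N : ℝ) ^ (-c₀) := by
      rw [le_inv_mul_iff₀ hρ0, ← pow_succ']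
      exact h3
    calc _ ≤ (N : ℝ) ^ 2 * (ρ⁻¹ * (N : ℝ) ^ (-c₀)) := h2.trans (by gcongr)
      _ = ρ⁻¹ * (N : ℝ) ^ (2 - c₀) := by
        rw [sub_eq_add_neg, Real.rpow_add hN0, Real.rpow_two]; ring
      _ ≤ _ := by
        gcongr
        · exact min_le_left _ _
  have herr : (k + 1) * (N : ℝ) * (Q : ℝ) ^ n ≤ (k + 1) * (N : ℝ) ^ (2 - min c₀ (1 / 2)) := by
    have h1 : (Q : ℝ) ^ n ≤ (N : ℝ) ^ (1 / 2 : ℝ) := by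
      rw [← Real.sqrt_eq_rpow]
      refine Real.le_sqrt_of_sq_le ?_
      rw [← pow_mul, mul_comm, pow_mul]
      exact_mod_cast hQn
    calc _ ≤ (k + 1) * (N : ℝ) * (N : ℝ) ^ (1 / 2 : ℝ) := by gcongr
      _ = (k + 1) * (N : ℝ) ^ (2 - 1 / 2 : ℝ) := by
        rw [show (2 - 1 / 2 : ℝ) = 1 + 1 / 2 by norm_num, Real.rpow_add hN0, Real.rpow_one]; ring
      _ ≤ _ := by
        gcongr
        · exact min_le_right _ _
  rw [add_mul]
  linarith

/-- The indicator function of `plusSet` is `(1 + a) / 2`; the expansion of its product over a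
progression gives the correlations of `a`. -/
theorem two_pow_mul_apCount {k : ℕ} (hk : 2 ≤ k) {a : ℕ → ℤ} (ha : ∀ n, a n = 1 ∨ a n = -1)
    (N : ℕ) : (2 : ℝ) ^ k * apCount k (plusSet a N) =
      ∑ S ∈ (Finset.range k).powerset, ∑ p ∈ apPairs k N, ∏ i ∈ S, (a (p.1 + i * p.2) : ℝ) := by
  have hset : {p : ℕ × ℕ | 0 < p.2 ∧ ∀ i < k, p.1 + i * p.2 ∈ plusSet a N} =
      ((apPairs k N).filter fun p => ∀ i ∈ Finset.range k, a (p.1 + i * p.2) = 1 :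
        Finset (ℕ × ℕ)) := by
    ext p
    simp only [plusSet, Set.mem_ofPred_eq, Finset.coe_filter, mem_apPairs hk, Finset.mem_range]
    constructor
    · rintro ⟨h0, h⟩
      exact ⟨⟨h0, (h (k - 1) (by omega)).1⟩, fun i hi => (h i hi).2⟩
    · rintro ⟨⟨h0, h1⟩, h⟩
      refine ⟨h0, fun i hi => ⟨?_, h i hi⟩⟩
      have : i * p.2 ≤ (k - 1) * p.2 := Nat.mul_le_mul_right _ (by omega)
      omega
  rw [apCount, hset, Set.ncard_coe_finset, Finset.card_filter, Finset.sum_comm, Nat.cast_sum,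
    Finset.mul_sum]
  refine Finset.sum_congr rfl fun p _ => ?_
  rw [← Finset.prod_one_add]
  split_ifs with h
  · rw [Finset.prod_congr rfl fun i hi => by rw [h i hi]]
    norm_num
  · push Not at h
    obtain ⟨i, hi, hne⟩ := h
    rw [Finset.prod_eq_zero hi (by rw [(ha _).resolve_left hne]; norm_num)]
    simp

theorem IsBinaryGenerated.exists_abs_apCount_sub_le {a : Bool → ℕ → ℤ} (ha : IsBinaryGenerated a)
    {k : ℕ} (hk : 2 ≤ k) : ∃ c : ℝ, 0 < c ∧ ∃ C : ℝ, 0 < C ∧ ∀ N : ℕ, 1 ≤ N →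
      |(apCount k (plusSet (a false) N) : ℝ) - (N : ℝ) ^ 2 / (2 ^ (k + 1) * ((k : ℝ) - 1))|
        ≤ C * (N : ℝ) ^ (2 - c) := by
  obtain ⟨c, hc, hc2, C, hC, h⟩ := ha.exists_abs_sum_le hk
  refine ⟨c, hc, 2 + C, by positivity, fun N hN => ?_⟩
  have hN1 : (1 : ℝ) ≤ N := by exact_mod_cast hN
  have hk' : (2 : ℝ) ≤ k := by exact_mod_cast hk
  have hcount := two_pow_mul_apCount hk (ha.eq_one_or false) N
  rw [← Finset.add_sum_erase _ _ (Finset.empty_mem_powerset _)] at hcount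
  simp only [Finset.prod_empty, Finset.sum_const, nsmul_eq_mul, mul_one] at hcount
  have hrest : |∑ S ∈ (Finset.range k).powerset.erase ∅, ∑ p ∈ apPairs k N,
      ∏ i ∈ S, (a false (p.1 + i * p.2) : ℝ)| ≤ 2 ^ k * (C * (N : ℝ) ^ (2 - c)) := by
    refine (Finset.abs_sum_le_sum_abs _ _).trans ?_
    refine (Finset.sum_le_card_nsmul _ _ (C * (N : ℝ) ^ (2 - c)) fun S hS => ?_).trans ?_
    · rw [Finset.mem_erase, Finset.mem_powerset] at hS
      exact h N hN S hS.2 (Finset.nonempty_iff_ne_empty.2 hS.1)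
    · rw [nsmul_eq_mul]
      gcongr
      have := Finset.card_erase_le (s := (Finset.range k).powerset) (a := ∅)
      rw [Finset.card_powerset, Finset.card_range] at this
      exact_mod_cast this
  have hmain := abs_card_apPairs_sub_le hk N
  have hle : (N : ℝ) ≤ (N : ℝ) ^ (2 - c) := by
    conv_lhs => rw [← Real.rpow_one (N : ℝ)]
    exact Real.rpow_le_rpow_of_exponent_le hN1 (by linarith)
  have h2k : (1 : ℝ) ≤ 2 ^ k := one_le_pow₀ (by norm_num)
  have hle' : (N : ℝ) ≤ 2 ^ k * (N : ℝ) ^ (2 - c) :=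
    hle.trans (le_mul_of_one_le_left (by positivity) h2k)
  rw [← mul_le_mul_iff_right₀ (by positivity : (0 : ℝ) < 2 ^ k), ← abs_of_pos
    (by positivity : (0 : ℝ) < 2 ^ k), ← abs_mul, abs_of_pos (by positivity : (0 : ℝ) < 2 ^ k),
    mul_sub, hcount]
  have hdiv : (2 : ℝ) ^ k * ((N : ℝ) ^ 2 / (2 ^ (k + 1) * ((k : ℝ) - 1))) =
      (N : ℝ) ^ 2 / (2 * ((k : ℝ) - 1)) := by
    have : (k : ℝ) - 1 ≠ 0 := by linarith
    field_simp; ring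
  rw [hdiv, add_sub_right_comm]
  refine (abs_add_le _ _).trans ?_
  linarith

theorem mainTheorem3 (k : ℕ) (hk : 2 ≤ k) :
    (∃ c : ℝ, 0 < c ∧ ∃ C : ℝ, 0 < C ∧ ∀ N : ℕ, 1 ≤ N →
      |(apCount k (plusSet thueMorse N) : ℝ) - (N : ℝ) ^ 2 / (2 ^ (k + 1) * ((k : ℝ) - 1))|
        ≤ C * (N : ℝ) ^ (2 - c)) ∧
    (∃ c : ℝ, 0 < c ∧ ∃ C : ℝ, 0 < C ∧ ∀ N : ℕ, 1 ≤ N →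
      |(apCount k (plusSet rudinShapiro N) : ℝ) - (N : ℝ) ^ 2 / (2 ^ (k + 1) * ((k : ℝ) - 1))|
        ≤ C * (N : ℝ) ^ (2 - c)) := by
  have hrs : rudinShapiroPair false = rudinShapiro := by
    ext n; simp [rudinShapiroPair]
  exact ⟨isBinaryGenerated_thueMorse.exists_abs_apCount_sub_le hk,
    hrs ▸ isBinaryGenerated_rudinShapiroPair.exists_abs_apCount_sub_le hk⟩
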